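/- Let $\mu,\rho>0$, and put $a_N=\left(\frac{\mu}{\rho}\right)^N\frac{e^{-\mu/\rho}}{N!}$ and $\gamma_N(\underline v_N)=\prod_{i=1}^N e^{-\pi v_i^2}$ for $N\ge 0$ and $\underline v_N=(v_1,\dots,v_N)\in\mathbb R^N$, where $\mathbb R^0$ is a single point of mass $1$. Let $\mathbf h=(h_N)_{N\ge0}$ be a family of functions $h_N:\mathbb R^N\to\mathbb R$, each nonnegative almost everywhere, such that $\boldsymbol\Gamma\mathbf h:=(a_N\gamma_Nh_N)_{N\ge0}$ belongs to $L^1_s(\mathcal R)=\bigoplus_N L^1_s(\mathbb R^N)$, that is, each $a_N\gamma_Nh_N$ is integrable and (almost everywhere) symmetric under permutations of $v_1,\dots,v_N$, and $\sum_N\int|a_N\gamma_Nh_N|\,d\underline v_N<\infty$. Define \[ E(\mathbf h)=\sum_{N=0}^\infty a_N\int_{\mathbb R^N} h_N\gamma_N\,d\underline v_N,\qquad S(\mathbf h)=\sum_{N=0}^\infty a_N\int_{\mathbb R^N} h_N\log h_N\,\gamma_N\,d\underline v_N\in(-\infty,\infty], \] \[ \Psi(\mathbf h)=\sum_{N=0}^\infty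 a_N\int_{\mathbb R^{N+1}}\bigl(h_{N+1}(\underline v_{N+1})-h_N(\underline v_N)\bigr)\bigl(\log h_{N+1}(\underline v_{N+1})-\log h_N(\underline v_N)\bigr)\gamma_{N+1}(\underline v_{N+1})\,d\underline v_{N+1}\in[0,\infty], \] with the conventions $0\log 0=0$ and $(x-y)(\log x-\log y)=0$ if $x=y=0$ and $=+\infty$ if exactly one of $x,y\ge0$ vanishes. If $S(\mathbf h)<\infty$, then \[ S(\mathbf h)\le E(\mathbf h)\log E(\mathbf h)+\frac{\mu}{\rho}\,\Psi(\mathbf h). \] -/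

import Mathlib

open MeasureTheory
open scoped ENNReal

noncomputable section

namespace GrandKac

/-- A family `(h_N)_{N ≥ 0}` of functions `h_N : ℝ^N → ℝ`, that is, a function on the phase space
`⋃_N ℝ^N`; `Fin 0 → ℝ` is the one-point space, on which `volume` is the unit mass. -/
abbrev State : Type := (N : ℕ) → (Fin N → ℝ) → ℝ

/-- The Maxwellian `γ_N(v) = ∏ i, exp (-π v_i²)` on `ℝ^N`. -/
def maxwellian (N : ℕ) (v : Fin N → ℝ) : ℝ :=
  ∏ i, Real.exp (-Real.pi * v i ^ 2)

/-- The Poisson weight `a_N = (μ/ρ)^N e^{-μ/ρ} / N!`. -/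
def poissonWeight (μ ρ : ℝ) (N : ℕ) : ℝ :=
  (μ / ρ) ^ N * Real.exp (-(μ / ρ)) / (N.factorial : ℝ)

/-- The family `Γ h`, with components `a_N γ_N h_N`. -/
def gammaMul (μ ρ : ℝ) (h : State) : State :=
  fun N v => poissonWeight μ ρ N * maxwellian N v * h N v

/-- Membership in `L¹_s = ⨁_N L¹_s(ℝ^N)`: each component is integrable and (almost everywhere)
symmetric under permutations of its arguments, and the sum of the `L¹` norms is finite. -/
structure MemL1s (f : State) : Prop where
  integrable : ∀ N, Integrable (f N) volume
  symmetric : ∀ (N : ℕ) (σ : Equiv.Perm (Fin N)),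
    ∀ᵐ v : Fin N → ℝ, f N (fun i => v (σ i)) = f N v
  summable : Summable fun N => ∫ v : Fin N → ℝ, |f N v|

/-- `h_N ≥ 0` almost everywhere, for every `N`. -/
def IsPositive (h : State) : Prop :=
  ∀ N, ∀ᵐ v : Fin N → ℝ, 0 ≤ h N v

/-- `E(h) = ∑_N a_N ∫ h_N γ_N dv`. -/
def mass (μ ρ : ℝ) (h : State) : ℝ :=
  ∑' N : ℕ, poissonWeight μ ρ N * ∫ v : Fin N → ℝ, h N v * maxwellian N v

/-- The contribution of the positive part of `h log h` to the entropy. -/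
def entropyPos (μ ρ : ℝ) (h : State) : ℝ≥0∞ :=
  ∑' N : ℕ, ENNReal.ofReal (poissonWeight μ ρ N) *
    ∫⁻ v : Fin N → ℝ, ENNReal.ofReal (h N v * Real.log (h N v) * maxwellian N v)

/-- The contribution of the negative part of `h log h` to the entropy. As `x log x ≥ -1/e` for
`x ≥ 0`, it is at most `1/e` for positive `h`. -/
def entropyNeg (μ ρ : ℝ) (h : State) : ℝ≥0∞ :=
  ∑' N : ℕ, ENNReal.ofReal (poissonWeight μ ρ N) *
    ∫⁻ v : Fin N → ℝ, ENNReal.ofReal (-(h N v * Real.log (h N v) * maxwellian N v))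

/-- `S(h) = ∑_N a_N ∫ h_N log h_N γ_N dv`, with values in `(-∞, ∞]` for positive `h`. -/
def entropy (μ ρ : ℝ) (h : State) : EReal :=
  (entropyPos μ ρ h : EReal) - (entropyNeg μ ρ h : EReal)

/-- `(x - y)(log x - log y) ∈ [0, ∞]` for `x, y ≥ 0`, with `log 0 = -∞`: it is `0` if `x = y`
(also if both vanish) and `∞` if exactly one of the two vanishes. -/
def productionDensity (x y : ℝ) : ℝ≥0∞ :=
  if x = y then 0
  else if x ≤ 0 ∨ y ≤ 0 then ⊤
  else ENNReal.ofReal ((x - y) * (Real.log x - Real.log y))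

/-- `Ψ(h) = ∑_N a_N ∫ (h_{N+1} - h_N)(log h_{N+1} - log h_N) γ_{N+1} dv_1 … dv_{N+1}`, where `h_N`
is evaluated at `(v_1, …, v_N)`. -/
def entropyProduction (μ ρ : ℝ) (h : State) : ℝ≥0∞ :=
  ∑' N : ℕ, ENNReal.ofReal (poissonWeight μ ρ N) *
    ∫⁻ v : Fin (N + 1) → ℝ,
      productionDensity (h (N + 1) v) (h N fun i => v i.castSucc) *
        ENNReal.ofReal (maxwellian (N + 1) v)

end GrandKac

end

open MeasureTheory
open scoped ENNReal

noncomputable section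

namespace GrandKac

/-- The density `p log (p / q) - p + q` of the relative entropy of two positive measures. -/
def relDensity (p q : ℝ) : ℝ := p * (Real.log p - Real.log q) - p + q

lemma relDensity_self (p : ℝ) : relDensity p p = 0 := by simp [relDensity]

lemma relDensity_nonneg {p q : ℝ} (hp : 0 < p) (hq : 0 < q) : 0 ≤ relDensity p q := by
  have h := Real.log_le_sub_one_of_pos (div_pos hq hp)
  rw [Real.log_div hq.ne' hp.ne'] at h
  have h' := mul_le_mul_of_nonneg_left h hp.le
  have e : p * (q / p - 1) = q - p := by field_simp
  unfold relDensity
  linarith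

/-- `relDensity` is convex and homogeneous, hence lies above its tangent planes. -/
lemma tangent_le_relDensity {p q a b : ℝ} (hp : 0 < p) (hq : 0 < q) (ha : 0 < a) (hb : 0 < b) :
    p * (Real.log a - Real.log b) + q * (1 - a / b) ≤ relDensity p q := by
  have h := relDensity_nonneg hp (div_pos (mul_pos hq ha) hb)
  unfold relDensity at *
  rw [Real.log_div (by positivity) hb.ne', Real.log_mul hq.ne' ha.ne'] at h
  have e : q * (1 - a / b) = q - q * a / b := by ring
  rw [e]
  linarith

lemma relDensity_le_mul {p q : ℝ} (hp : 0 < p) (hq : 0 < q) :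
    relDensity p q ≤ (p - q) * (Real.log p - Real.log q) := by
  have h := relDensity_nonneg hq hp
  unfold relDensity at *
  linarith

lemma relDensity_mem_Icc {c C p q : ℝ} (hc : 0 < c) (hp : p ∈ Set.Icc c C) (hq : q ∈ Set.Icc c C) :
    relDensity p q ∈ Set.Icc 0 (C * (Real.log C - Real.log c) + C) := by
  have hp0 := hc.trans_le hp.1
  have hq0 := hc.trans_le hq.1
  refine ⟨relDensity_nonneg hp0 hq0, ?_⟩
  have h1 := Real.log_le_log hp0 hp.2
  have h2 := Real.log_le_log hc hq.1
  have h3 := Real.log_le_log hc (hp.1.trans hp.2)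
  have h4 : p * (Real.log p - Real.log q) ≤ C * (Real.log C - Real.log c) :=
    (mul_le_mul_of_nonneg_left (by linarith) hp0.le).trans
      (mul_le_mul_of_nonneg_right hp.2 (by linarith))
  unfold relDensity
  linarith [hq.2]

@[fun_prop]
lemma measurable_relDensity {α : Type*} [MeasurableSpace α] {p q : α → ℝ} (hp : Measurable p)
    (hq : Measurable q) : Measurable fun x => relDensity (p x) (q x) := by
  unfold relDensity; fun_prop

/-- `n ↦ s ^ n e ^ {-s} / n!`. -/
def poissonMass (s : ℝ) (n : ℕ) : ℝ := s ^ n * Real.exp (-s) / (n.factorial : ℝ)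

lemma poissonMass_nonneg {s : ℝ} (hs : 0 ≤ s) (n : ℕ) : 0 ≤ poissonMass s n := by
  unfold poissonMass; positivity

lemma hasSum_poissonMass (s : ℝ) : HasSum (poissonMass s) 1 := by
  have h := (NormedSpace.expSeries_div_hasSum_exp (𝔸 := ℝ) s).mul_right (Real.exp (-s))
  rw [← Real.exp_eq_exp_ℝ, ← Real.exp_add, add_neg_cancel, Real.exp_zero] at h
  refine h.congr_fun ?_
  intro n
  unfold poissonMass; ring

lemma tsum_ofReal_poissonMass {s : ℝ} (hs : 0 ≤ s) :
    ∑' n, ENNReal.ofReal (poissonMass s n) = 1 := by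
  rw [← ENNReal.ofReal_tsum_of_nonneg (poissonMass_nonneg hs) (hasSum_poissonMass s).summable,
    (hasSum_poissonMass s).tsum_eq, ENNReal.ofReal_one]

lemma sum_antidiagonal_poissonMass (s t : ℝ) (n : ℕ) :
    ∑ ij ∈ Finset.HasAntidiagonal.antidiagonal n, poissonMass s ij.1 * poissonMass t ij.2
      = poissonMass (s + t) n := by
  unfold poissonMass
  rw [neg_add, Real.exp_add, (Commute.all s t).add_pow', Finset.sum_mul, Finset.sum_div]
  refine Finset.sum_congr rfl fun ij hij => ?_
  have hn := Finset.HasAntidiagonal.mem_antidiagonal.1 hij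
  have h : ((n.choose ij.1 : ℝ)) * (ij.1.factorial * ij.2.factorial) = n.factorial := by
    rw [← hn]
    exact_mod_cast by
      have := Nat.add_choose_mul_factorial_mul_factorial ij.1 ij.2
      rw [← mul_assoc, Nat.choose_symm_add]; exact this
  rw [← h]
  have h1 : ((n.choose ij.1 : ℝ)) ≠ 0 := by
    exact_mod_cast (Nat.choose_pos (by omega)).ne'
  rw [nsmul_eq_mul]
  field_simp

section CompoundPoisson

variable {M : Type*} [Monoid M] [MeasurableSpace M]

/-- Convolution powers of a measure. -/
def mconvPow (ν : Measure M) : ℕ → Measure M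
  | 0 => Measure.dirac 1
  | n + 1 => (mconvPow ν n).mconv ν

/-- The compound Poisson law with intensity `s` and jump law `ν`. -/
def compoundPoisson (ν : Measure M) (s : ℝ) : Measure M :=
  Measure.sum fun n => ENNReal.ofReal (poissonMass s n) • mconvPow ν n

lemma lintegral_compoundPoisson (ν : Measure M) (s : ℝ) (f : M → ℝ≥0∞) :
    ∫⁻ x, f x ∂compoundPoisson ν s
      = ∑' n, ENNReal.ofReal (poissonMass s n) * ∫⁻ x, f x ∂mconvPow ν n := by
  simp [compoundPoisson, lintegral_sum_measure, lintegral_smul_measure]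

variable [MeasurableMul₂ M] (ν : Measure M) [IsProbabilityMeasure ν]

instance isProbabilityMeasure_mconvPow : ∀ n, IsProbabilityMeasure (mconvPow ν n)
  | 0 => Measure.dirac.isProbabilityMeasure
  | n + 1 => by
    have := isProbabilityMeasure_mconvPow n
    exact Measure.probabilitymeasure_of_probabilitymeasures_mconv _ _

lemma mconvPow_add (m n : ℕ) : (mconvPow ν m).mconv (mconvPow ν n) = mconvPow ν (m + n) := by
  induction n with
  | zero => exact Measure.mconv_dirac_one _
  | succ n ih =>
    change (mconvPow ν m).mconv ((mconvPow ν n).mconv ν) = (mconvPow ν (m + n)).mconv ν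
    rw [← ih, Measure.mconv_assoc]

lemma mconvPow_one : mconvPow ν 1 = ν := Measure.dirac_one_mconv ν

lemma isProbabilityMeasure_compoundPoisson {s : ℝ} (hs : 0 ≤ s) :
    IsProbabilityMeasure (compoundPoisson ν s) := by
  refine ⟨?_⟩
  rw [← lintegral_one, lintegral_compoundPoisson]
  simp [tsum_ofReal_poissonMass hs]

lemma compoundPoisson_mconv {s t : ℝ} (hs : 0 ≤ s) (ht : 0 ≤ t) :
    (compoundPoisson ν s).mconv (compoundPoisson ν t) = compoundPoisson ν (s + t) := by
  have := isProbabilityMeasure_compoundPoisson ν hs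
  have := isProbabilityMeasure_compoundPoisson ν ht
  refine Measure.ext_of_lintegral _ fun f hf => ?_
  have key : ∀ m n, ∫⁻ x, ∫⁻ y, f (x * y) ∂mconvPow ν n ∂mconvPow ν m
      = ∫⁻ x, f x ∂mconvPow ν (m + n) := fun m n => by
    rw [← mconvPow_add, Measure.lintegral_mconv hf]
  rw [Measure.lintegral_mconv hf, lintegral_compoundPoisson, lintegral_compoundPoisson]
  simp_rw [lintegral_compoundPoisson]
  have h1 : ∀ m, ∫⁻ x, ∑' n, ENNReal.ofReal (poissonMass t n) *
        ∫⁻ y, f (x * y) ∂mconvPow ν n ∂mconvPow ν m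
      = ∑' n, ENNReal.ofReal (poissonMass t n) * ∫⁻ x, f x ∂mconvPow ν (m + n) := fun m => by
    have hm : ∀ n, Measurable fun x => ∫⁻ y, f (x * y) ∂mconvPow ν n := fun n =>
      Measurable.lintegral_prod_right' (f := fun z : M × M => f (z.1 * z.2)) (by fun_prop)
    rw [lintegral_tsum fun n => ((hm n).const_mul _).aemeasurable]
    simp_rw [lintegral_const_mul _ (hm _), key]
  simp_rw [h1, ← ENNReal.tsum_mul_left]
  rw [← ENNReal.tsum_prod (f := fun m n => ENNReal.ofReal (poissonMass s m) *
      (ENNReal.ofReal (poissonMass t n) * ∫⁻ x, f x ∂mconvPow ν (m + n))),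
    ← Finset.HasAntidiagonal.sigmaAntidiagonalEquivProd.tsum_eq, ENNReal.tsum_sigma']
  refine tsum_congr fun n => ?_
  rw [tsum_fintype, ← sum_antidiagonal_poissonMass,
    ENNReal.ofReal_sum_of_nonneg fun ij _ =>
      mul_nonneg (poissonMass_nonneg hs _) (poissonMass_nonneg ht _), Finset.sum_mul,
    ← Finset.sum_coe_sort (Finset.HasAntidiagonal.antidiagonal n)]
  refine Finset.sum_congr rfl fun ij _ => ?_
  have h2 := Finset.HasAntidiagonal.mem_antidiagonal.1 ij.2
  simp only [Finset.HasAntidiagonal.sigmaAntidiagonalEquivProd_apply]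
  rw [h2, ENNReal.ofReal_mul (poissonMass_nonneg hs _), mul_assoc]

lemma integral_mconv_of_mem_Icc {P Q : Measure M} [IsFiniteMeasure P] [IsFiniteMeasure Q]
    {f : M → ℝ} (hf : Measurable f) {a b : ℝ} (hab : ∀ x, f x ∈ Set.Icc a b) :
    ∫ x, f x ∂(P.mconv Q) = ∫ x, ∫ y, f (x * y) ∂Q ∂P := by
  rw [Measure.mconv, integral_map measurable_mul.aemeasurable hf.aestronglyMeasurable]
  exact integral_prod _ (.of_mem_Icc a b (by fun_prop) (ae_of_all _ fun z => hab _))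

lemma integral_compoundPoisson_add {s t : ℝ} (hs : 0 ≤ s) (ht : 0 ≤ t)
    {f : M → ℝ} (hf : Measurable f) {a b : ℝ} (hab : ∀ x, f x ∈ Set.Icc a b) :
    ∫ x, f x ∂compoundPoisson ν (s + t)
      = ∫ x, ∫ y, f (x * y) ∂compoundPoisson ν t ∂compoundPoisson ν s := by
  have := isProbabilityMeasure_compoundPoisson ν hs
  have := isProbabilityMeasure_compoundPoisson ν ht
  rw [← compoundPoisson_mconv ν hs ht, integral_mconv_of_mem_Icc hf hab]

lemma hasSum_integral_compoundPoisson {s : ℝ} (hs : 0 ≤ s)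
    {f : M → ℝ} (hf : Measurable f) {a b : ℝ} (hab : ∀ x, f x ∈ Set.Icc a b) :
    HasSum (fun n => poissonMass s n * ∫ x, f x ∂mconvPow ν n)
      (∫ x, f x ∂compoundPoisson ν s) := by
  have := isProbabilityMeasure_compoundPoisson ν hs
  have h := hasSum_integral_measure (f := f)
    (μ := fun n => ENNReal.ofReal (poissonMass s n) • mconvPow ν n)
    (Integrable.of_mem_Icc (μ := compoundPoisson ν s) a b hf.aemeasurable (ae_of_all _ hab))
  simp only [integral_smul_measure, ENNReal.toReal_ofReal (poissonMass_nonneg hs _),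
    smul_eq_mul] at h
  exact h

lemma integral_compoundPoisson_zero {f : M → ℝ} (hf : Measurable f) {a b : ℝ}
    (hab : ∀ x, f x ∈ Set.Icc a b) : ∫ x, f x ∂compoundPoisson ν 0 = f 1 := by
  have h := hasSum_integral_compoundPoisson ν le_rfl hf hab
  have h' := hasSum_single (f := fun n => poissonMass 0 n * ∫ x, f x ∂mconvPow ν n) 0
    fun n hn => by simp [poissonMass, hn]
  rw [h.unique h']
  simp [poissonMass, mconvPow, integral_dirac' _ _ hf.stronglyMeasurable]

lemma exp_neg_mul_le_integral_compoundPoisson {s : ℝ} (hs : 0 ≤ s) {f : M → ℝ} (hf : Measurable f)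
    {K : ℝ} (hK : ∀ x, f x ∈ Set.Icc 0 K) :
    Real.exp (-s) * f 1 ≤ ∫ x, f x ∂compoundPoisson ν s := by
  have h := le_hasSum (hasSum_integral_compoundPoisson ν hs hf hK) 0 fun n _ =>
    mul_nonneg (poissonMass_nonneg hs n) (integral_nonneg fun x => (hK x).1)
  simpa [poissonMass, mconvPow, integral_dirac' _ _ hf.stronglyMeasurable] using h

/-- First-order expansion of the compound Poisson law at small intensity. -/
lemma integral_compoundPoisson_le {s : ℝ} (hs : 0 ≤ s) {f : M → ℝ} (hf : Measurable f)
    {K : ℝ} (hK : ∀ x, f x ∈ Set.Icc 0 K) :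
    ∫ x, f x ∂compoundPoisson ν s
      ≤ Real.exp (-s) * f 1 + s * Real.exp (-s) * ∫ x, f x ∂ν + K * s ^ 2 := by
  have h := (hasSum_nat_add_iff' 2).2 (hasSum_integral_compoundPoisson ν hs hf hK)
  have h' := ((hasSum_nat_add_iff' 2).2 (hasSum_poissonMass s)).mul_right K
  have hle := hasSum_le (fun n => mul_le_mul_of_nonneg_left (?_ : _ ≤ K)
    (poissonMass_nonneg hs (n + 2))) h h'
  · have hK0 : 0 ≤ K := (hK 1).1.trans (hK 1).2
    have hr : 1 - ∑ i ∈ Finset.range 2, poissonMass s i ≤ s ^ 2 := by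
      have := Real.add_one_le_exp (-s)
      have h3 : (1 + s) * (-s + 1) ≤ (1 + s) * Real.exp (-s) :=
        mul_le_mul_of_nonneg_left this (by linarith)
      simp only [Finset.sum_range_succ, Finset.sum_range_zero, poissonMass]
      norm_num
      nlinarith
    have h4 := hle.trans (mul_le_mul_of_nonneg_right hr hK0)
    rw [Finset.sum_range_succ, Finset.sum_range_one, mconvPow_one] at h4
    simp only [mconvPow, poissonMass, integral_dirac' _ _ hf.stronglyMeasurable] at h4
    norm_num at h4
    linarith
  · have := integral_mono (μ := mconvPow ν (n + 2))
      (Integrable.of_mem_Icc 0 K hf.aemeasurable (ae_of_all _ hK)) (integrable_const K)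
      fun x => (hK x).2
    simpa using this

end CompoundPoisson

section Jensen

variable {α : Type*} [MeasurableSpace α] {P : Measure α} [IsProbabilityMeasure P] {c C : ℝ}

lemma integral_mem_Icc {f : α → ℝ} (hf : Measurable f) {a b : ℝ} (hb : ∀ x, f x ∈ Set.Icc a b) :
    ∫ x, f x ∂P ∈ Set.Icc a b := by
  have hi : Integrable f P := .of_mem_Icc a b hf.aemeasurable (ae_of_all _ hb)
  have h1 := integral_mono (integrable_const a) hi fun x => (hb x).1
  have h2 := integral_mono hi (integrable_const b) fun x => (hb x).2
  simp only [integral_const, probReal_univ, one_smul] at h1 h2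
  exact ⟨h1, h2⟩

lemma mul_log_mem_Icc (hc : 0 < c) {x : ℝ} (hx : x ∈ Set.Icc c C) :
    x * Real.log x ∈ Set.Icc (-1) (C ^ 2) := by
  have hx0 := hc.trans_le hx.1
  constructor
  · linarith [Real.self_sub_one_le_mul_log hx0.le]
  · have := mul_le_mul_of_nonneg_left (Real.log_le_self hx0.le) hx0.le
    nlinarith [hx.2]

/-- The entropy is at most the mean relative entropy density with respect to any constant. -/
lemma integral_mul_log_le (hc : 0 < c) {f : α → ℝ} (hf : Measurable f)
    (hb : ∀ x, f x ∈ Set.Icc c C) {b : ℝ} (hb0 : 0 < b) :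
    ∫ x, f x * Real.log (f x) ∂P
      ≤ (∫ x, f x ∂P) * Real.log (∫ x, f x ∂P) + ∫ x, relDensity (f x) b ∂P := by
  have hi : Integrable f P := .of_mem_Icc c C hf.aemeasurable (ae_of_all _ hb)
  have hl : Integrable (fun x => f x * Real.log (f x)) P :=
    .of_mem_Icc (-1) (C ^ 2) (by fun_prop) (ae_of_all _ fun x => mul_log_mem_Icc hc (hb x))
  have ha := hc.trans_le (integral_mem_Icc (P := P) hf hb).1
  have h := relDensity_nonneg ha hb0
  have e : ∫ x, relDensity (f x) b ∂P = ∫ x, f x * Real.log (f x) ∂P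
      - (∫ x, f x ∂P) * (Real.log b + 1) + b := by
    have : ∀ x, relDensity (f x) b = f x * Real.log (f x) - f x * (Real.log b + 1) + b := fun x => by
      unfold relDensity; ring
    simp_rw [this]
    rw [integral_add (by exact hl.sub (hi.mul_const _)) (integrable_const b),
      integral_sub hl (hi.mul_const _), integral_mul_const]
    simp
  unfold relDensity at h
  rw [e]
  linarith

/-- Jensen's inequality for `relDensity`. -/
lemma relDensity_integral_le (hc : 0 < c) {p q : α → ℝ} (hp : Measurable p) (hq : Measurable q)
    (hpb : ∀ x, p x ∈ Set.Icc c C) (hqb : ∀ x, q x ∈ Set.Icc c C) :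
    relDensity (∫ x, p x ∂P) (∫ x, q x ∂P) ≤ ∫ x, relDensity (p x) (q x) ∂P := by
  have hip : Integrable p P := .of_mem_Icc c C hp.aemeasurable (ae_of_all _ hpb)
  have hiq : Integrable q P := .of_mem_Icc c C hq.aemeasurable (ae_of_all _ hqb)
  have ha := hc.trans_le (integral_mem_Icc (P := P) hp hpb).1
  have hb := hc.trans_le (integral_mem_Icc (P := P) hq hqb).1
  set a := ∫ x, p x ∂P
  set b := ∫ x, q x ∂P
  have hir : Integrable (fun x => relDensity (p x) (q x)) P :=
    .of_mem_Icc _ _ (by fun_prop)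
      (ae_of_all _ fun x => relDensity_mem_Icc hc (hpb x) (hqb x))
  have h := integral_mono ((hip.mul_const (Real.log a - Real.log b)).add
    (hiq.mul_const (1 - a / b))) hir fun x =>
      tangent_le_relDensity (hc.trans_le (hpb x).1) (hc.trans_le (hqb x).1) ha hb
  have e : ∫ x, ((fun x => p x * (Real.log a - Real.log b)) + fun x => q x * (1 - a / b)) x ∂P
      = a * (Real.log a - Real.log b) + b * (1 - a / b) := by
    rw [integral_add' (hip.mul_const _) (hiq.mul_const _), integral_mul_const, integral_mul_const]
  rw [e] at h
  refine le_trans (le_of_eq ?_) h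
  unfold relDensity
  field_simp
  ring

end Jensen

section Semigroup

variable {M : Type*} [Monoid M] [MeasurableSpace M]

/-- The average of `h` over the configurations that extend `x` by a compound Poisson sample. -/
def poissonAvg (ν : Measure M) (s : ℝ) (h : M → ℝ) (x : M) : ℝ :=
  ∫ y, h (x * y) ∂compoundPoisson ν s

/-- The mean relative entropy density between `h` at a configuration with and without an added
point. -/
def relProduction (ν : Measure M) (h : M → ℝ) (s : ℝ) : ℝ :=
  ∫ x, ∫ y, relDensity (h (x * y)) (h x) ∂ν ∂compoundPoisson ν s

variable [MeasurableMul₂ M] (ν : Measure M) [IsProbabilityMeasure ν] {h : M → ℝ} {c C : ℝ}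

lemma measurable_integral_right {α β : Type*} [MeasurableSpace α] [MeasurableSpace β]
    (Q : Measure β) [SFinite Q] {f : α → β → ℝ} (hf : Measurable (Function.uncurry f)) :
    Measurable fun x => ∫ y, f x y ∂Q :=
  (StronglyMeasurable.integral_prod_right (f := f) hf.stronglyMeasurable).measurable

lemma measurable_integral_mul (Q : Measure M) [SFinite Q] {f : M → ℝ} (hf : Measurable f) :
    Measurable fun x => ∫ y, f (x * y) ∂Q :=
  measurable_integral_right Q (hf.comp measurable_mul)

lemma measurable_poissonAvg {s : ℝ} (hs : 0 ≤ s) (hm : Measurable h) :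
    Measurable (poissonAvg ν s h) := by
  have := isProbabilityMeasure_compoundPoisson ν hs
  exact measurable_integral_mul _ hm

lemma poissonAvg_mem_Icc {s : ℝ} (hs : 0 ≤ s) (hm : Measurable h)
    (hb : ∀ x, h x ∈ Set.Icc c C) (x : M) : poissonAvg ν s h x ∈ Set.Icc c C := by
  have := isProbabilityMeasure_compoundPoisson ν hs
  exact integral_mem_Icc (by fun_prop) fun y => hb _

lemma poissonAvg_add {s t : ℝ} (hs : 0 ≤ s) (ht : 0 ≤ t) (hm : Measurable h)
    (hb : ∀ x, h x ∈ Set.Icc c C) (x : M) :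
    poissonAvg ν (s + t) h x = ∫ y, poissonAvg ν t h (x * y) ∂compoundPoisson ν s := by
  unfold poissonAvg
  rw [integral_compoundPoisson_add ν hs ht (f := fun y => h (x * y)) (by fun_prop) fun y => hb _]
  simp_rw [mul_assoc]

/-- Jensen's inequality and exchangeability: averaging decreases the production. -/
lemma integral_relDensity_poissonAvg_le {s t : ℝ} (hs : 0 ≤ s) (ht : 0 ≤ t) (hc : 0 < c)
    (hm : Measurable h) (hb : ∀ x, h x ∈ Set.Icc c C)
    (hsym : ∀ x y z, h (x * y * z) = h (x * z * y)) :
    ∫ x, ∫ y, relDensity (poissonAvg ν s h (x * y)) (poissonAvg ν s h x) ∂ν ∂compoundPoisson ν t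
      ≤ relProduction ν h (t + s) := by
  have := isProbabilityMeasure_compoundPoisson ν hs
  have := isProbabilityMeasure_compoundPoisson ν ht
  have hg := measurable_poissonAvg ν hs hm
  have hgb := poissonAvg_mem_Icc ν hs hm hb
  have hRb : ∀ x y, relDensity (h x) (h y) ∈ Set.Icc 0 (C * (Real.log C - Real.log c) + C) :=
    fun x y => relDensity_mem_Icc hc (hb x) (hb y)
  set K := C * (Real.log C - Real.log c) + C
  have hF : Measurable fun w => ∫ y, relDensity (h (w * y)) (h w) ∂ν :=
    measurable_integral_right ν
      (by fun_prop)
  have hFb : ∀ w, ∫ y, relDensity (h (w * y)) (h w) ∂ν ∈ Set.Icc 0 K := fun w =>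
    integral_mem_Icc (by fun_prop) fun y => hRb _ _
  unfold relProduction
  rw [integral_compoundPoisson_add ν ht hs hF hFb]
  refine integral_mono (.of_mem_Icc 0 K ?_ (ae_of_all _ fun x => ?_))
    (.of_mem_Icc 0 K ?_ (ae_of_all _ fun x => ?_)) fun x => ?_
  · exact Measurable.aemeasurable (measurable_integral_right ν (by fun_prop))
  · exact integral_mem_Icc
      (by fun_prop)
      fun y => relDensity_mem_Icc hc (hgb _) (hgb _)
  · exact (measurable_integral_mul _ hF).aemeasurable
  · exact integral_mem_Icc (hF.comp (measurable_const_mul x)) fun y => hFb _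
  · have hswap : ∫ z, ∫ y, relDensity (h (x * z * y)) (h (x * z)) ∂ν ∂compoundPoisson ν s
        = ∫ y, ∫ z, relDensity (h (x * z * y)) (h (x * z)) ∂compoundPoisson ν s ∂ν :=
      integral_integral_swap (.of_mem_Icc 0 K
        (by fun_prop) (ae_of_all _ fun z => hRb _ _))
    change _ ≤ ∫ z, ∫ y, relDensity (h (x * z * y)) (h (x * z)) ∂ν ∂compoundPoisson ν s
    rw [hswap]
    refine integral_mono (.of_mem_Icc 0 K ?_ (ae_of_all _ fun y => ?_))
      (.of_mem_Icc 0 K ?_ (ae_of_all _ fun y => ?_)) fun y => ?_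
    · fun_prop
    · exact relDensity_mem_Icc hc (hgb _) (hgb _)
    · exact Measurable.aemeasurable (measurable_integral_right _ (by fun_prop))
    · exact integral_mem_Icc (by fun_prop) fun z => hRb _ _
    · simp_rw [fun z => hsym x z y]
      exact relDensity_integral_le hc (by fun_prop) (by fun_prop) (fun z => hb _) fun z => hb _

lemma relProduction_le {s t : ℝ} (hs : 0 ≤ s) (ht : 0 ≤ t) (hc : 0 < c)
    (hm : Measurable h) (hb : ∀ x, h x ∈ Set.Icc c C) :
    Real.exp (-s) * relProduction ν h t ≤ relProduction ν h (t + s) := by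
  have := isProbabilityMeasure_compoundPoisson ν hs
  have := isProbabilityMeasure_compoundPoisson ν ht
  have hF : Measurable fun w => ∫ y, relDensity (h (w * y)) (h w) ∂ν :=
    measurable_integral_right ν
      (by fun_prop)
  have hFb : ∀ w, ∫ y, relDensity (h (w * y)) (h w) ∂ν
      ∈ Set.Icc 0 (C * (Real.log C - Real.log c) + C) := fun w =>
    integral_mem_Icc (by fun_prop)
      fun y => relDensity_mem_Icc hc (hb _) (hb _)
  unfold relProduction
  rw [integral_compoundPoisson_add ν ht hs hF hFb, ← integral_const_mul]
  refine integral_mono ((Integrable.of_mem_Icc _ _ hF.aemeasurable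
    (ae_of_all _ hFb)).const_mul _) (.of_mem_Icc _ _ (measurable_integral_mul _ hF).aemeasurable
      (ae_of_all _ fun x => integral_mem_Icc (hF.comp (measurable_const_mul x)) fun y => hFb _)) fun x => ?_
  have h1 := exp_neg_mul_le_integral_compoundPoisson ν hs
    (f := fun y => ∫ z, relDensity (h (x * y * z)) (h (x * y)) ∂ν)
    (hF.comp (measurable_const_mul x)) fun y => hFb _
  simpa only [mul_one] using h1

/-- The entropy gained along the interpolation when the intensity increases by `ε`. -/
lemma integral_mul_log_poissonAvg_le {s t ε : ℝ} (hs : 0 ≤ s) (ht : 0 ≤ t) (hε : 0 ≤ ε)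
    (hc : 0 < c) (hm : Measurable h) (hb : ∀ x, h x ∈ Set.Icc c C)
    (hsym : ∀ x y z, h (x * y * z) = h (x * z * y)) :
    ∫ x, poissonAvg ν s h x * Real.log (poissonAvg ν s h x) ∂compoundPoisson ν (t + ε)
      ≤ ∫ x, poissonAvg ν (ε + s) h x * Real.log (poissonAvg ν (ε + s) h x) ∂compoundPoisson ν t
        + ε * relProduction ν h (t + s + ε) + (C * (Real.log C - Real.log c) + C) * ε ^ 2 := by
  have := isProbabilityMeasure_compoundPoisson ν hε
  have := isProbabilityMeasure_compoundPoisson ν ht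
  have hg := measurable_poissonAvg ν hs hm
  have hgb := poissonAvg_mem_Icc ν hs hm hb
  have hG := measurable_poissonAvg ν (add_nonneg hε hs) hm
  have hGb := poissonAvg_mem_Icc ν (add_nonneg hε hs) hm hb
  have hadd := poissonAvg_add ν hε hs hm hb
  have h1 := integral_relDensity_poissonAvg_le ν hs ht hc hm hb hsym
  have h2 := relProduction_le ν hε (add_nonneg ht hs) hc hm hb
  set K := C * (Real.log C - Real.log c) + C
  set g := poissonAvg ν s h
  have hgK : ∀ x y, relDensity (g (x * y)) (g x) ∈ Set.Icc 0 K := fun x y =>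
    relDensity_mem_Icc hc (hgb _) (hgb _)
  have hD : Measurable fun x => ∫ y, relDensity (g (x * y)) (g x) ∂ν :=
    measurable_integral_right ν
      (by fun_prop)
  have hDi : Integrable (fun x => ∫ y, relDensity (g (x * y)) (g x) ∂ν) (compoundPoisson ν t) :=
    .of_mem_Icc 0 K hD.aemeasurable (ae_of_all _ fun x =>
      integral_mem_Icc (by fun_prop) (hgK x))
  have hGi : Integrable (fun x => poissonAvg ν (ε + s) h x *
      Real.log (poissonAvg ν (ε + s) h x)) (compoundPoisson ν t) :=
    .of_mem_Icc _ _ (by fun_prop) (ae_of_all _ fun x => mul_log_mem_Icc hc (hGb x))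
  have hgl : Measurable fun x => g x * Real.log (g x) := by fun_prop
  have hglb : ∀ x, g x * Real.log (g x) ∈ Set.Icc (-1) (C ^ 2) := fun x =>
    mul_log_mem_Icc hc (hgb x)
  rw [integral_compoundPoisson_add ν ht hε hgl hglb]
  have hpt : ∀ x, ∫ y, g (x * y) * Real.log (g (x * y)) ∂compoundPoisson ν ε
      ≤ poissonAvg ν (ε + s) h x * Real.log (poissonAvg ν (ε + s) h x)
        + ε * Real.exp (-ε) * ∫ y, relDensity (g (x * y)) (g x) ∂ν + K * ε ^ 2 := fun x => by
    have h3 := integral_mul_log_le (P := compoundPoisson ν ε) hc (f := fun y => g (x * y))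
      (by fun_prop) (fun y => hgb _) (hc.trans_le (hgb x).1)
    have h4 := integral_compoundPoisson_le ν hε (f := fun y => relDensity (g (x * y)) (g x))
      (by fun_prop) (hgK x)
    rw [hadd x]
    rw [mul_one, relDensity_self, mul_zero, zero_add] at h4
    linarith
  have h5 := integral_mono (μ := compoundPoisson ν t) (.of_mem_Icc _ _
    (measurable_integral_mul _ hgl).aemeasurable
      (ae_of_all _ fun x => integral_mem_Icc (by fun_prop) fun y => hglb _))
    ((hGi.add (hDi.const_mul (ε * Real.exp (-ε)))).add (integrable_const (K * ε ^ 2))) hpt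
  rw [integral_add' (hGi.add (hDi.const_mul _)) (integrable_const _),
    integral_add' hGi (hDi.const_mul _), integral_const_mul] at h5
  simp only [integral_const, probReal_univ, one_smul] at h5
  have h6 := mul_le_mul_of_nonneg_left
    ((mul_le_mul_of_nonneg_left h1 (Real.exp_pos (-ε)).le).trans h2) hε
  rw [← mul_assoc] at h6
  exact h5.trans (by linarith)

/-- The modified logarithmic Sobolev inequality of compound Poisson laws, for exchangeable
functions bounded away from zero and infinity. -/
theorem integral_mul_log_compoundPoisson_le {s : ℝ} (hs : 0 ≤ s) (hc : 0 < c)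
    (hm : Measurable h) (hb : ∀ x, h x ∈ Set.Icc c C)
    (hsym : ∀ x y z, h (x * y * z) = h (x * z * y)) :
    ∫ x, h x * Real.log (h x) ∂compoundPoisson ν s
      ≤ (∫ x, h x ∂compoundPoisson ν s) * Real.log (∫ x, h x ∂compoundPoisson ν s)
        + s * relProduction ν h s := by
  set K := C * (Real.log C - Real.log c) + C with hK
  have hn : ∀ n : ℕ, ∫ x, h x * Real.log (h x) ∂compoundPoisson ν s
      ≤ (∫ x, h x ∂compoundPoisson ν s) * Real.log (∫ x, h x ∂compoundPoisson ν s)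
        + s * relProduction ν h s + K * s ^ 2 * (1 / ((n : ℝ) + 1)) := fun n => by
    set ε := s / (n + 1) with hεdef
    have hn0 : (0 : ℝ) < n + 1 := by positivity
    have hε : 0 ≤ ε := by positivity
    have hεs : (n + 1) * ε = s := by rw [hεdef]; field_simp
    have hj : ∀ j : ℕ, j ≤ n + 1 →
        ∫ x, poissonAvg ν (s - j * ε) h x * Real.log (poissonAvg ν (s - j * ε) h x)
            ∂compoundPoisson ν (j * ε)
          ≤ (∫ x, h x ∂compoundPoisson ν s) * Real.log (∫ x, h x ∂compoundPoisson ν s)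
            + j * (ε * relProduction ν h s + K * ε ^ 2) := by
      intro j
      induction j with
      | zero =>
        intro _
        have hg := measurable_poissonAvg ν hs hm
        have hgb := poissonAvg_mem_Icc ν hs hm hb
        have h0 := integral_compoundPoisson_zero ν
          (f := fun x => poissonAvg ν s h x * Real.log (poissonAvg ν s h x)) (by fun_prop)
          fun x => mul_log_mem_Icc hc (hgb x)
        simp only [Nat.cast_zero, zero_mul, sub_zero, add_zero, h0]
        simp [poissonAvg]
      | succ j ih =>
        intro hj
        have hj' : ((j : ℝ) + 1) ≤ n + 1 := by exact_mod_cast hj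
        have hle : ((j : ℝ) + 1) * ε ≤ s := hεs ▸ mul_le_mul_of_nonneg_right hj' hε
        have hstep := integral_mul_log_poissonAvg_le ν (s := s - (j + 1) * ε) (t := j * ε)
          (by linarith) (by positivity) hε hc hm hb hsym
        have e1 : ε + (s - (j + 1) * ε) = s - j * ε := by ring
        have e2 : j * ε + (s - (j + 1) * ε) + ε = s := by ring
        have e3 : j * ε + ε = (j + 1) * ε := by ring
        rw [e1, e2, e3] at hstep
        have := ih (by omega)
        push_cast
        linarith
    have hlast := hj (n + 1) le_rfl
    push_cast at hlast
    rw [hεs, sub_self] at hlast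
    have h0 : ∀ x, poissonAvg ν 0 h x = h x := fun x => by
      have := integral_compoundPoisson_zero ν (f := fun y => h (x * y)) (by fun_prop) fun y => hb _
      simpa [poissonAvg] using this
    simp_rw [h0] at hlast
    have e4 : (n + 1) * (ε * relProduction ν h s + K * ε ^ 2)
        = s * relProduction ν h s + K * s ^ 2 * (1 / ((n : ℝ) + 1)) := by
      rw [hεdef]; field_simp
    linarith
  have hlim := (tendsto_one_div_add_atTop_nhds_zero_nat (𝕜 := ℝ)).const_mul (K * s ^ 2)
  have hlim' := hlim.const_add ((∫ x, h x ∂compoundPoisson ν s) *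
    Real.log (∫ x, h x ∂compoundPoisson ν s) + s * relProduction ν h s)
  rw [mul_zero, add_zero] at hlim'
  exact ge_of_tendsto' hlim' hn

end Semigroup

/-- Truncation to the interval `[1 / (n + 1), n + 1]`. -/
def trunc (n : ℕ) (x : ℝ) : ℝ := max (1 / ((n : ℝ) + 1)) (min x (n + 1))

lemma one_div_le_succ (n : ℕ) : 1 / ((n : ℝ) + 1) ≤ n + 1 := by
  have hn : (0 : ℝ) ≤ n := n.cast_nonneg
  exact ((div_le_one (by linarith)).2 (by linarith)).trans (by linarith)

lemma trunc_mem_Icc (n : ℕ) (x : ℝ) : trunc n x ∈ Set.Icc (1 / ((n : ℝ) + 1)) (n + 1) :=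
  ⟨le_max_left _ _, max_le (one_div_le_succ n) (min_le_right _ _)⟩

lemma trunc_pos (n : ℕ) (x : ℝ) : 0 < trunc n x :=
  lt_of_lt_of_le (by positivity) (trunc_mem_Icc n x).1

lemma measurable_trunc (n : ℕ) : Measurable (trunc n) := by
  unfold trunc; fun_prop

lemma trunc_mono (n : ℕ) : Monotone (trunc n) := fun _ _ h =>
  max_le_max le_rfl (min_le_min h le_rfl)

lemma trunc_sub_trunc_le (n : ℕ) {p q : ℝ} (h : q ≤ p) : trunc n p - trunc n q ≤ p - q := by
  have hcC := one_div_le_succ n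
  unfold trunc
  rcases le_total p (n + 1) with h1 | h1 <;> rcases le_total q (n + 1) with h2 | h2 <;>
    simp only [min_eq_left, min_eq_right, h1, h2] <;>
    simp only [max_def] <;> split_ifs <;> linarith

lemma trunc_mul_le (n : ℕ) {p q : ℝ} (hq : 0 < q) (h : q ≤ p) :
    trunc n p * q ≤ p * trunc n q := by
  have hcC := one_div_le_succ n
  have hc : (0 : ℝ) < 1 / ((n : ℝ) + 1) := by positivity
  have hC : (0 : ℝ) < (n : ℝ) + 1 := by positivity
  unfold trunc
  rcases le_total p (n + 1) with h1 | h1 <;> rcases le_total q (n + 1) with h2 | h2 <;>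
    simp only [min_eq_left, min_eq_right, h1, h2] <;>
    simp only [max_def] <;> split_ifs <;> nlinarith

lemma trunc_production_le (n : ℕ) {p q : ℝ} (hp : 0 < p) (hq : 0 < q) :
    (trunc n p - trunc n q) * (Real.log (trunc n p) - Real.log (trunc n q))
      ≤ (p - q) * (Real.log p - Real.log q) := by
  wlog h : q ≤ p generalizing p q
  · have := this hq hp (not_le.1 h).le
    linarith
  have hp' := trunc_pos n p
  have hq' := trunc_pos n q
  refine mul_le_mul (trunc_sub_trunc_le n h) ?_
    (sub_nonneg.2 (Real.log_le_log hq' (trunc_mono n h))) (sub_nonneg.2 h)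
  have := Real.log_le_log (by positivity) (trunc_mul_le n hq h)
  rw [Real.log_mul hp'.ne' hq.ne', Real.log_mul hp.ne' hq'.ne'] at this
  linarith

lemma ofReal_relDensity_trunc_le (n : ℕ) (p q : ℝ) :
    ENNReal.ofReal (relDensity (trunc n p) (trunc n q)) ≤ productionDensity p q := by
  unfold productionDensity
  split_ifs with h1 h2
  · rw [h1, relDensity_self, ENNReal.ofReal_zero]
  · exact le_top
  · push Not at h2
    exact ENNReal.ofReal_le_ofReal
      ((relDensity_le_mul (trunc_pos n p) (trunc_pos n q)).trans (trunc_production_le n h2.1 h2.2))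

lemma tendsto_trunc {x : ℝ} (hx : 0 ≤ x) :
    Filter.Tendsto (fun n => trunc n x) Filter.atTop (nhds x) := by
  have h1 : Filter.Tendsto (fun n : ℕ => max (1 / ((n : ℝ) + 1)) x) Filter.atTop (nhds x) := by
    have := (tendsto_one_div_add_atTop_nhds_zero_nat (𝕜 := ℝ)).max
      (tendsto_const_nhds (x := x) (f := Filter.atTop))
    rwa [max_eq_right hx] at this
  refine h1.congr' ?_
  obtain ⟨N, hN⟩ := exists_nat_ge x
  filter_upwards [Filter.eventually_ge_atTop N] with n hn
  have : (N : ℝ) ≤ n := by exact_mod_cast hn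
  rw [trunc, min_eq_left (by linarith)]

lemma abs_trunc_le (n : ℕ) {x : ℝ} (hx : 0 ≤ x) : |trunc n x| ≤ 1 + x := by
  rw [abs_of_pos (trunc_pos n x)]
  refine max_le ?_ ((min_le_left _ _).trans (by linarith))
  have hn : (0 : ℝ) ≤ n := n.cast_nonneg
  exact ((div_le_one (by linarith)).2 (by linarith)).trans (by linarith)

lemma abs_trunc_mul_log_le (n : ℕ) (x : ℝ) :
    |trunc n x * Real.log (trunc n x)| ≤ 1 + |x * Real.log x| := by
  have ht := trunc_pos n x
  have hn : (0 : ℝ) ≤ n := n.cast_nonneg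
  rcases le_total (trunc n x) 1 with h1 | h1
  · have h2 := Real.self_sub_one_le_mul_log ht.le
    have h3 : trunc n x * Real.log (trunc n x) ≤ 0 :=
      mul_nonpos_of_nonneg_of_nonpos ht.le (Real.log_nonpos ht.le h1)
    rw [abs_of_nonpos h3]
    have := abs_nonneg (x * Real.log x)
    linarith
  · have h0 : 0 ≤ Real.log (trunc n x) := Real.log_nonneg h1
    rw [abs_of_nonneg (mul_nonneg ht.le h0)]
    rcases le_or_gt (trunc n x) x with h2 | h2
    · have := mul_le_mul h2 (Real.log_le_log ht h2) h0 (ht.le.trans h2)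
      linarith [le_abs_self (x * Real.log x)]
    · have h3 : trunc n x ≤ 1 := by
        unfold trunc at h2 ⊢
        rcases lt_max_iff.1 h2 with h4 | h4
        · refine max_le ((div_le_one (by linarith)).2 (by linarith)) ((min_le_left _ _).trans
            (h4.le.trans ((div_le_one (by linarith)).2 (by linarith))))
        · exact absurd (min_le_left _ _) (not_le.2 h4)
      have h4 : trunc n x = 1 := le_antisymm h3 h1
      rw [h4, Real.log_one]
      linarith [abs_nonneg (x * Real.log x)]

section LogSobolev

variable {M : Type*} [Monoid M] [MeasurableSpace M] [MeasurableMul₂ M]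
  (ν : Measure M) [IsProbabilityMeasure ν]

lemma relProduction_trunc_le {s : ℝ} (hs : 0 ≤ s) {H : M → ℝ} (hm : Measurable H)
    (hD : ∫⁻ x, ∫⁻ y, productionDensity (H (x * y)) (H x) ∂ν ∂compoundPoisson ν s ≠ ⊤) (n : ℕ) :
    relProduction ν (fun x => trunc n (H x)) s
      ≤ (∫⁻ x, ∫⁻ y, productionDensity (H (x * y)) (H x) ∂ν ∂compoundPoisson ν s).toReal := by
  have := isProbabilityMeasure_compoundPoisson ν hs
  have ht := measurable_trunc n
  have hc : (0 : ℝ) < 1 / ((n : ℝ) + 1) := by positivity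
  have hb : ∀ x y, relDensity (trunc n (H (x * y))) (trunc n (H x)) ∈ Set.Icc _ _ := fun x y =>
    relDensity_mem_Icc hc (trunc_mem_Icc n _) (trunc_mem_Icc n _)
  have hF : Measurable fun x => ∫ y, relDensity (trunc n (H (x * y))) (trunc n (H x)) ∂ν :=
    measurable_integral_right ν (by fun_prop)
  unfold relProduction
  rw [integral_eq_lintegral_of_nonneg_ae (ae_of_all _ fun x => integral_nonneg fun y => (hb x y).1)
    hF.aestronglyMeasurable]
  refine ENNReal.toReal_mono hD (lintegral_mono fun x => ?_)
  rw [ofReal_integral_eq_lintegral_ofReal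
    (.of_mem_Icc _ _ (by fun_prop) (ae_of_all _ (hb x))) (ae_of_all _ fun y => (hb x y).1)]
  exact lintegral_mono fun y => ofReal_relDensity_trunc_le n _ _

/-- The modified logarithmic Sobolev inequality of compound Poisson laws. -/
theorem integral_mul_log_le_add_productionDensity {s : ℝ} (hs : 0 ≤ s) {H : M → ℝ}
    (hm : Measurable H) (hpos : ∀ x, 0 ≤ H x) (hsym : ∀ x y z, H (x * y * z) = H (x * z * y))
    (hi : Integrable H (compoundPoisson ν s))
    (hl : Integrable (fun x => H x * Real.log (H x)) (compoundPoisson ν s))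
    (hD : ∫⁻ x, ∫⁻ y, productionDensity (H (x * y)) (H x) ∂ν ∂compoundPoisson ν s ≠ ⊤) :
    ∫ x, H x * Real.log (H x) ∂compoundPoisson ν s
      ≤ (∫ x, H x ∂compoundPoisson ν s) * Real.log (∫ x, H x ∂compoundPoisson ν s)
        + s * (∫⁻ x, ∫⁻ y, productionDensity (H (x * y)) (H x) ∂ν ∂compoundPoisson ν s).toReal := by
  have := isProbabilityMeasure_compoundPoisson ν hs
  have ht := measurable_trunc
  have h1 : Filter.Tendsto (fun n => ∫ x, trunc n (H x) ∂compoundPoisson ν s) Filter.atTop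
      (nhds (∫ x, H x ∂compoundPoisson ν s)) :=
    tendsto_integral_of_dominated_convergence (fun x => 1 + H x)
      (fun n => ((ht n).comp hm).aestronglyMeasurable) ((integrable_const 1).add hi)
      (fun n => ae_of_all _ fun x => abs_trunc_le n (hpos x))
      (ae_of_all _ fun x => tendsto_trunc (hpos x))
  have h2 : Filter.Tendsto (fun n => ∫ x, trunc n (H x) * Real.log (trunc n (H x))
      ∂compoundPoisson ν s) Filter.atTop
      (nhds (∫ x, H x * Real.log (H x) ∂compoundPoisson ν s)) :=
    tendsto_integral_of_dominated_convergence (fun x => 1 + |H x * Real.log (H x)|)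
      (fun n => by have := ht n; exact Measurable.aestronglyMeasurable (by fun_prop))
      ((integrable_const 1).add hl.abs)
      (fun n => ae_of_all _ fun x => abs_trunc_mul_log_le n (H x))
      (ae_of_all _ fun x => (Real.continuous_mul_log.tendsto _).comp (tendsto_trunc (hpos x)))
  refine le_of_tendsto_of_tendsto' h2
    (((Real.continuous_mul_log.tendsto _).comp h1).add_const _) fun n => ?_
  have h3 := integral_mul_log_compoundPoisson_le ν hs (h := fun x => trunc n (H x))
    (by positivity) ((ht n).comp hm) (fun x => trunc_mem_Icc n (H x))
    fun x y z => by rw [hsym]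
  exact h3.trans (add_le_add le_rfl
    (mul_le_mul_of_nonneg_left (relProduction_trunc_le ν hs hm hD n) hs))

end LogSobolev

section Configuration

/-- The length and the entries, padded by zeros, of a finite sequence of velocities. -/
def entries (l : FreeMonoid ℝ) : ℕ × (ℕ → ℝ) :=
  (l.toList.length, fun i => l.toList.getD i 0)

instance instMeasurableSpaceConfig : MeasurableSpace (FreeMonoid ℝ) :=
  MeasurableSpace.comap entries inferInstance

lemma measurable_entries : Measurable entries := comap_measurable _

lemma measurable_freeMonoid {α : Type*} [MeasurableSpace α] {f : α → FreeMonoid ℝ}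
    (hn : Measurable fun a => (f a).toList.length)
    (he : ∀ i, Measurable fun a => (f a).toList.getD i 0) : Measurable f :=
  measurable_comap_iff.2 (hn.prodMk (measurable_pi_iff.2 he))

instance instMeasurableMulConfig : MeasurableMul₂ (FreeMonoid ℝ) := by
  refine ⟨measurable_freeMonoid ?_ fun i => ?_⟩
  · have h : Measurable fun z : FreeMonoid ℝ × FreeMonoid ℝ =>
        (entries z.1).1 + (entries z.2).1 :=
      (measurable_entries.comp measurable_fst).fst.add (measurable_entries.comp measurable_snd).fst
    simpa [entries] using h
  · have hG : Measurable fun z : ℕ × (ℕ → ℝ) × (ℕ → ℝ) =>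
        if i < z.1 then z.2.1 i else z.2.2 (i - z.1) := by
      refine measurable_from_prod_countable_right fun n => ?_
      change Measurable fun w : (ℕ → ℝ) × (ℕ → ℝ) => if i < n then w.1 i else w.2 (i - n)
      split_ifs <;> fun_prop
    have h1 : Measurable fun z : FreeMonoid ℝ × FreeMonoid ℝ => entries z.1 :=
      measurable_entries.comp measurable_fst
    have h2 : Measurable fun z : FreeMonoid ℝ × FreeMonoid ℝ => entries z.2 :=
      measurable_entries.comp measurable_snd
    convert hG.comp (h1.fst.prodMk (h1.snd.prodMk h2.snd)) using 1
    funext z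
    simp only [Function.comp_apply, entries, FreeMonoid.toList_mul]
    split_ifs with h
    · exact List.getD_append _ _ _ _ h
    · exact List.getD_append_right _ _ _ _ (not_lt.1 h)

/-- The finite sequence with entries `v 0, …, v (N - 1)`. -/
def ofTuple {N : ℕ} (v : Fin N → ℝ) : FreeMonoid ℝ := FreeMonoid.ofList (List.ofFn v)

lemma entries_ofTuple {N : ℕ} (v : Fin N → ℝ) :
    entries (ofTuple v) = (N, fun i => if h : i < N then v ⟨i, h⟩ else 0) := by
  refine Prod.ext (by simp [entries, ofTuple]) (funext fun i => ?_)
  by_cases h : i < N <;> simp [entries, ofTuple, h, List.getD_eq_getElem?_getD]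

lemma measurable_ofTuple (N : ℕ) : Measurable (ofTuple (N := N)) := by
  refine measurable_comap_iff.2 ?_
  have : entries ∘ ofTuple (N := N)
      = fun v : Fin N → ℝ => (N, fun i : ℕ => if h : i < N then v ⟨i, h⟩ else 0) :=
    funext entries_ofTuple
  rw [this]
  refine measurable_const.prodMk (measurable_pi_iff.2 fun i => ?_)
  split_ifs <;> fun_prop

lemma ofTuple_zero (v : Fin 0 → ℝ) : ofTuple v = 1 := by simp [ofTuple]

lemma ofTuple_snoc {N : ℕ} (v : Fin N → ℝ) (t : ℝ) :
    ofTuple (Fin.snoc v t : Fin (N + 1) → ℝ) = ofTuple v * FreeMonoid.of t := by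
  apply FreeMonoid.toList.injective
  rw [ofTuple, FreeMonoid.toList_ofList, List.ofFn_succ']
  simp [ofTuple]

lemma exists_eq_ofTuple (l : FreeMonoid ℝ) : ∃ (N : ℕ) (v : Fin N → ℝ), l = ofTuple v :=
  ⟨l.toList.length, fun i => l.toList[i], FreeMonoid.toList.injective (by simp [ofTuple])⟩

@[fun_prop]
lemma measurable_freeMonoid_of : Measurable (FreeMonoid.of : ℝ → FreeMonoid ℝ) := by
  have h : (FreeMonoid.of : ℝ → FreeMonoid ℝ) = fun t => ofTuple (fun _ : Fin 1 => t) :=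
    funext fun t => FreeMonoid.toList.injective (by simp [ofTuple])
  rw [h]
  exact (measurable_ofTuple 1).comp (measurable_pi_iff.2 fun _ => measurable_id)

/-- A family of functions of `N` variables, as a function on finite sequences. -/
def onConfig (F : State) (l : FreeMonoid ℝ) : ℝ :=
  F (entries l).1 fun i => (entries l).2 i

lemma onConfig_ofTuple (F : State) {N : ℕ} (v : Fin N → ℝ) : onConfig F (ofTuple v) = F N v := by
  unfold onConfig
  rw [entries_ofTuple]
  simp

lemma measurable_onConfig {F : State} (hF : ∀ N, Measurable (F N)) : Measurable (onConfig F) := by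
  have h : Measurable fun z : ℕ × (ℕ → ℝ) => F z.1 fun i => z.2 i :=
    measurable_from_prod_countable_right fun n =>
      (hF n).comp (measurable_pi_iff.2 fun i => measurable_pi_apply _)
  exact h.comp measurable_entries

lemma onConfig_eq_of_perm {F : State}
    (hF : ∀ (N : ℕ) (σ : Equiv.Perm (Fin N)) (v : Fin N → ℝ), F N (v ∘ σ) = F N v)
    {l l' : FreeMonoid ℝ} (h : l.toList.Perm l'.toList) : onConfig F l = onConfig F l' := by
  obtain ⟨N, v, rfl⟩ := exists_eq_ofTuple l
  obtain ⟨N', w, rfl⟩ := exists_eq_ofTuple l'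
  obtain rfl : N = N' := by simpa [ofTuple] using h.length_eq
  have h' : (List.ofFn v).Perm (List.ofFn w) := h
  have hs : v ∘ Tuple.sort v = w ∘ Tuple.sort w :=
    List.ofFn_injective ((((Tuple.sort v).ofFn_comp_perm v).trans (h'.trans
      ((Tuple.sort w).ofFn_comp_perm w).symm)).eq_of_pairwise'
        (Tuple.monotone_sort v).sortedLE_ofFn.pairwise
        (Tuple.monotone_sort w).sortedLE_ofFn.pairwise)
  rw [onConfig_ofTuple, onConfig_ofTuple, ← hF N (Tuple.sort v), hs, hF]

end Configuration

section Gaussian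

lemma maxwellian_pos (N : ℕ) (v : Fin N → ℝ) : 0 < maxwellian N v :=
  Finset.prod_pos fun _ _ => Real.exp_pos _

lemma measurable_maxwellian (N : ℕ) : Measurable (maxwellian N) := by
  unfold maxwellian; fun_prop

lemma maxwellian_snoc {N : ℕ} (v : Fin N → ℝ) (t : ℝ) :
    maxwellian (N + 1) (Fin.snoc v t : Fin (N + 1) → ℝ)
      = maxwellian N v * Real.exp (-Real.pi * t ^ 2) := by
  simp [maxwellian, Fin.prod_univ_castSucc]

lemma maxwellian_comp_perm {N : ℕ} (σ : Equiv.Perm (Fin N)) (v : Fin N → ℝ) :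
    maxwellian N (fun i => v (σ i)) = maxwellian N v :=
  Equiv.prod_comp σ fun i => Real.exp (-Real.pi * v i ^ 2)

/-- The law of a single Maxwellian velocity, on configurations. -/
def velocityLaw : Measure (FreeMonoid ℝ) :=
  (volume.withDensity fun t : ℝ => ENNReal.ofReal (Real.exp (-Real.pi * t ^ 2))).map FreeMonoid.of

lemma lintegral_velocityLaw {f : FreeMonoid ℝ → ℝ≥0∞} (hf : Measurable f) :
    ∫⁻ x, f x ∂velocityLaw
      = ∫⁻ t : ℝ, f (FreeMonoid.of t) * ENNReal.ofReal (Real.exp (-Real.pi * t ^ 2)) := by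
  rw [velocityLaw, lintegral_map hf measurable_freeMonoid_of,
    lintegral_withDensity_eq_lintegral_mul _ (by fun_prop) (by fun_prop)]
  exact lintegral_congr fun t => mul_comm _ _

instance isProbabilityMeasure_velocityLaw : IsProbabilityMeasure velocityLaw := by
  refine ⟨?_⟩
  rw [← lintegral_one, lintegral_velocityLaw measurable_const]
  simp_rw [one_mul]
  rw [← ofReal_integral_eq_lintegral_ofReal (integrable_exp_neg_mul_sq Real.pi_pos)
    (ae_of_all _ fun t => (Real.exp_pos _).le), integral_gaussian, div_self Real.pi_ne_zero]
  simp

lemma lintegral_snoc {N : ℕ} {g : (Fin (N + 1) → ℝ) → ℝ≥0∞} (hg : Measurable g) :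
    ∫⁻ v, g v = ∫⁻ v : Fin N → ℝ, ∫⁻ t : ℝ, g (Fin.snoc v t) := by
  have e := (volume_preserving_piFinSuccAbove (fun _ : Fin (N + 1) => ℝ) (Fin.last N)).symm
  rw [← e.lintegral_comp hg, Measure.volume_eq_prod, lintegral_prod_symm]
  · refine lintegral_congr fun v => lintegral_congr fun t => ?_
    simp [MeasurableEquiv.piFinSuccAbove, Fin.insertNthEquiv, Fin.insertNth_last']
  · exact (hg.comp e.measurable).aemeasurable

lemma lintegral_mconvPow_velocityLaw (N : ℕ) {f : FreeMonoid ℝ → ℝ≥0∞} (hf : Measurable f) :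
    ∫⁻ x, f x ∂mconvPow velocityLaw N
      = ∫⁻ v : Fin N → ℝ, f (ofTuple v) * ENNReal.ofReal (maxwellian N v) := by
  induction N generalizing f with
  | zero =>
    have hv : (volume : Measure (Fin 0 → ℝ)) Set.univ = 1 := by simp [volume_pi]
    simp [mconvPow, lintegral_dirac' _ hf, ofTuple_zero, maxwellian, hv]
  | succ N ih =>
    have hfm : Measurable fun x => ∫⁻ y, f (x * y) ∂velocityLaw :=
      Measurable.lintegral_prod_right' (f := fun z : FreeMonoid ℝ × FreeMonoid ℝ => f (z.1 * z.2))
        (by fun_prop)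
    rw [mconvPow, Measure.lintegral_mconv hf, ih hfm, lintegral_snoc]
    · refine lintegral_congr fun v => ?_
      rw [lintegral_velocityLaw (by fun_prop), ← lintegral_mul_const _ (by fun_prop)]
      refine lintegral_congr fun t => ?_
      rw [ofTuple_snoc, maxwellian_snoc, ENNReal.ofReal_mul (maxwellian_pos _ _).le, mul_assoc,
        mul_comm (ENNReal.ofReal (maxwellian N v))]
    · exact (hf.comp (measurable_ofTuple _)).mul (measurable_maxwellian _).ennreal_ofReal

@[fun_prop]
lemma measurable_productionDensity {α : Type*} [MeasurableSpace α] {p q : α → ℝ}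
    (hp : Measurable p) (hq : Measurable q) :
    Measurable fun x => productionDensity (p x) (q x) := by
  unfold productionDensity
  refine Measurable.ite (measurableSet_eq_fun hp hq) measurable_const
    (Measurable.ite ?_ measurable_const (by fun_prop))
  exact (measurableSet_le hp measurable_const).union (measurableSet_le hq measurable_const)

lemma lintegral_productionDensity_mconvPow (N : ℕ) {F : State} (hF : ∀ N, Measurable (F N)) :
    ∫⁻ x, ∫⁻ y, productionDensity (onConfig F (x * y)) (onConfig F x) ∂velocityLaw
        ∂mconvPow velocityLaw N
      = ∫⁻ v : Fin (N + 1) → ℝ, productionDensity (F (N + 1) v) (F N fun i => v i.castSucc) *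
          ENNReal.ofReal (maxwellian (N + 1) v) := by
  have hH := measurable_onConfig hF
  have hD : Measurable fun x => ∫⁻ y, productionDensity (onConfig F (x * y)) (onConfig F x)
      ∂velocityLaw :=
    Measurable.lintegral_prod_right' (f := fun z : FreeMonoid ℝ × FreeMonoid ℝ =>
      productionDensity (onConfig F (z.1 * z.2)) (onConfig F z.1)) (by fun_prop)
  rw [lintegral_mconvPow_velocityLaw N hD, lintegral_snoc]
  · refine lintegral_congr fun v => ?_
    rw [lintegral_velocityLaw (by fun_prop), ← lintegral_mul_const _ (by fun_prop)]
    refine lintegral_congr fun t => ?_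
    rw [← ofTuple_snoc, onConfig_ofTuple, onConfig_ofTuple, maxwellian_snoc,
      ENNReal.ofReal_mul (maxwellian_pos _ _).le, mul_assoc,
      mul_comm (ENNReal.ofReal (maxwellian N v))]
    simp
  · have hc : Measurable fun v : Fin (N + 1) → ℝ => F N fun i => v i.castSucc :=
      (hF N).comp (measurable_pi_iff.2 fun i => measurable_pi_apply _)
    have hM := measurable_maxwellian (N + 1)
    have hF1 := hF (N + 1)
    fun_prop

end Gaussian

section Representative

lemma poissonWeight_pos {μ ρ : ℝ} (hμ : 0 < μ) (hρ : 0 < ρ) (N : ℕ) :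
    0 < poissonWeight μ ρ N := by
  unfold poissonWeight; positivity

lemma measurePreserving_comp_perm {N : ℕ} (σ : Equiv.Perm (Fin N)) :
    MeasurePreserving (fun (v : Fin N → ℝ) i => v (σ i)) volume volume := by
  have h := volume_measurePreserving_piCongrLeft (fun _ : Fin N => ℝ) σ.symm
  convert h using 1
  funext v i
  exact (Equiv.piCongrLeft_apply_apply (fun _ : Fin N => ℝ) σ.symm v (σ i)).symm.trans
    (by simp; rfl)

lemma quasiMeasurePreserving_castSucc (N : ℕ) :
    Measure.QuasiMeasurePreserving (fun (v : Fin (N + 1) → ℝ) (i : Fin N) => v i.castSucc)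
      volume volume := by
  have e := (volume_preserving_piFinSuccAbove (fun _ : Fin (N + 1) => ℝ) (Fin.last N))
  have h := (Measure.quasiMeasurePreserving_snd (μ := (volume : Measure ℝ))
    (ν := (volume : Measure (Fin N → ℝ)))).comp e.quasiMeasurePreserving
  have he : (fun (v : Fin (N + 1) → ℝ) (i : Fin N) => v i.castSucc)
      = Prod.snd ∘ MeasurableEquiv.piFinSuccAbove (fun _ : Fin (N + 1) => ℝ) (Fin.last N) := by
    funext v i
    simp [MeasurableEquiv.piFinSuccAbove, Fin.insertNthEquiv, Fin.init]
  rw [he]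
  exact h

/-- A function that is measurable, nonnegative and symmetric up to null sets agrees almost
everywhere with one that is so everywhere. -/
lemma exists_symmetric_representative {N : ℕ} {f : (Fin N → ℝ) → ℝ} (hf : AEMeasurable f volume)
    (hpos : ∀ᵐ v, 0 ≤ f v)
    (hsym : ∀ σ : Equiv.Perm (Fin N), ∀ᵐ v : Fin N → ℝ, f (fun i => v (σ i)) = f v) :
    ∃ F : (Fin N → ℝ) → ℝ, Measurable F ∧ (∀ v, 0 ≤ F v) ∧
      (∀ (σ : Equiv.Perm (Fin N)) v, F (v ∘ σ) = F v) ∧ f =ᵐ[volume] F := by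
  obtain ⟨g, hg, hfg⟩ := hf
  refine ⟨fun v => (∑ σ : Equiv.Perm (Fin N), |g fun i => v (σ i)|) / (N.factorial : ℝ),
    ?_, fun v => by positivity, fun σ v => ?_, ?_⟩
  · have : ∀ σ : Equiv.Perm (Fin N), Measurable fun v : Fin N → ℝ => g fun i => v (σ i) :=
      fun σ => hg.comp (measurePreserving_comp_perm σ).measurable
    fun_prop
  · have h := Equiv.sum_comp (Equiv.mulLeft σ) fun τ : Equiv.Perm (Fin N) => |g fun i => v (τ i)|
    exact congrArg (· / (N.factorial : ℝ)) h
  · have h1 : ∀ᵐ v : Fin N → ℝ, ∀ σ : Equiv.Perm (Fin N),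
        f (fun i => v (σ i)) = g fun i => v (σ i) :=
      ae_all_iff.2 fun σ => (measurePreserving_comp_perm σ).quasiMeasurePreserving.ae hfg
    filter_upwards [h1, ae_all_iff.2 hsym, hpos] with v hv1 hv2 hv3
    have h2 : ∀ σ : Equiv.Perm (Fin N), |g fun i => v (σ i)| = f v := fun σ => by
      rw [← hv1, hv2, abs_of_nonneg hv3]
    simp only [h2, Finset.sum_const, Finset.card_univ, Fintype.card_perm, Fintype.card_fin,
      nsmul_eq_mul]
    have : (N.factorial : ℝ) ≠ 0 := by positivity
    field_simp

lemma exists_representative {μ ρ : ℝ} (hμ : 0 < μ) (hρ : 0 < ρ) {h : State} (hpos : IsPositive h)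
    (hL1 : MemL1s (gammaMul μ ρ h)) :
    ∃ F : State, (∀ N, Measurable (F N)) ∧ (∀ N v, 0 ≤ F N v) ∧
      (∀ (N : ℕ) (σ : Equiv.Perm (Fin N)) v, F N (v ∘ σ) = F N v) ∧
        ∀ N, h N =ᵐ[volume] F N := by
  have hw : ∀ N v, poissonWeight μ ρ N * maxwellian N v ≠ 0 := fun N v =>
    (mul_pos (poissonWeight_pos hμ hρ N) (maxwellian_pos N v)).ne'
  have key : ∀ N, ∃ F : (Fin N → ℝ) → ℝ, Measurable F ∧ (∀ v, 0 ≤ F v) ∧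
      (∀ (σ : Equiv.Perm (Fin N)) v, F (v ∘ σ) = F v) ∧ h N =ᵐ[volume] F := fun N => by
    refine exists_symmetric_representative ?_ (hpos N) fun σ => ?_
    · have h1 : AEMeasurable (fun v => (poissonWeight μ ρ N * maxwellian N v)⁻¹ *
          gammaMul μ ρ h N v) volume :=
        (((measurable_maxwellian N).const_mul _).inv.aemeasurable).mul
          (hL1.integrable N).aemeasurable
      refine h1.congr (ae_of_all _ fun v => ?_)
      exact inv_mul_cancel_left₀ (hw N v) _
    · filter_upwards [hL1.symmetric N σ] with v hv
      unfold gammaMul at hv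
      rw [maxwellian_comp_perm] at hv
      exact mul_left_cancel₀ (hw N v) hv
  choose F h1 h2 h3 h4 using key
  exact ⟨F, h1, h2, h3, h4⟩

end Representative

section Translation

variable {μ ρ : ℝ} {h F : State}

lemma lintegral_compoundPoisson_onConfig (hF : ∀ N, Measurable (F N))
    (hFh : ∀ N, h N =ᵐ[volume] F N) {φ : ℝ → ℝ} (hφ : Measurable φ) :
    ∫⁻ x, ENNReal.ofReal (φ (onConfig F x)) ∂compoundPoisson velocityLaw (μ / ρ)
      = ∑' N, ENNReal.ofReal (poissonWeight μ ρ N) *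
          ∫⁻ v : Fin N → ℝ, ENNReal.ofReal (φ (h N v) * maxwellian N v) := by
  have hH := measurable_onConfig hF
  rw [lintegral_compoundPoisson]
  refine tsum_congr fun N => ?_
  rw [lintegral_mconvPow_velocityLaw N (by fun_prop)]
  congr 1
  refine lintegral_congr_ae ?_
  filter_upwards [hFh N] with v hv
  rw [hv, onConfig_ofTuple, ENNReal.ofReal_mul' (maxwellian_pos N v).le]

lemma entropyPos_eq_lintegral (hF : ∀ N, Measurable (F N)) (hFh : ∀ N, h N =ᵐ[volume] F N) :
    entropyPos μ ρ h = ∫⁻ x, ENNReal.ofReal (onConfig F x * Real.log (onConfig F x))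
      ∂compoundPoisson velocityLaw (μ / ρ) :=
  (lintegral_compoundPoisson_onConfig hF hFh (φ := fun x => x * Real.log x) (by fun_prop)).symm

lemma entropyNeg_eq_lintegral (hF : ∀ N, Measurable (F N)) (hFh : ∀ N, h N =ᵐ[volume] F N) :
    entropyNeg μ ρ h = ∫⁻ x, ENNReal.ofReal (-(onConfig F x * Real.log (onConfig F x)))
      ∂compoundPoisson velocityLaw (μ / ρ) := by
  rw [lintegral_compoundPoisson_onConfig hF hFh (φ := fun x => -(x * Real.log x)) (by fun_prop)]
  simp_rw [neg_mul]
  rfl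

lemma entropyProduction_eq_lintegral (hF : ∀ N, Measurable (F N))
    (hFh : ∀ N, h N =ᵐ[volume] F N) :
    entropyProduction μ ρ h = ∫⁻ x, ∫⁻ y, productionDensity (onConfig F (x * y)) (onConfig F x)
      ∂velocityLaw ∂compoundPoisson velocityLaw (μ / ρ) := by
  rw [lintegral_compoundPoisson]
  refine tsum_congr fun N => ?_
  rw [lintegral_productionDensity_mconvPow N hF]
  congr 1
  refine lintegral_congr_ae ?_
  filter_upwards [hFh (N + 1), (quasiMeasurePreserving_castSucc N).ae (hFh N)] with v hv1 hv2
  rw [hv1, hv2]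

lemma lintegral_onConfig_eq_mass (hμ : 0 < μ) (hρ : 0 < ρ) (hpos : IsPositive h)
    (hL1 : MemL1s (gammaMul μ ρ h)) (hF : ∀ N, Measurable (F N))
    (hFh : ∀ N, h N =ᵐ[volume] F N) :
    ∫⁻ x, ENNReal.ofReal (onConfig F x) ∂compoundPoisson velocityLaw (μ / ρ)
      = ENNReal.ofReal (mass μ ρ h) := by
  have hnn : ∀ N, ∀ᵐ v, 0 ≤ gammaMul μ ρ h N v := fun N => by
    filter_upwards [hpos N] with v hv
    exact mul_nonneg (mul_pos (poissonWeight_pos hμ hρ N) (maxwellian_pos N v)).le hv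
  have hint : ∀ N, poissonWeight μ ρ N * ∫ v : Fin N → ℝ, h N v * maxwellian N v
      = ∫ v, gammaMul μ ρ h N v := fun N => by
    rw [← integral_const_mul]
    refine integral_congr_ae (ae_of_all _ fun v => ?_)
    simp only [gammaMul]
    ring
  have hsum : Summable fun N => ∫ v, gammaMul μ ρ h N v := by
    refine hL1.summable.congr fun N => integral_congr_ae ?_
    filter_upwards [hnn N] with v hv
    exact abs_of_nonneg hv
  rw [lintegral_compoundPoisson_onConfig hF hFh (φ := fun x => x) measurable_id, mass]
  simp_rw [hint]
  rw [ENNReal.ofReal_tsum_of_nonneg (fun N => integral_nonneg_of_ae (hnn N)) hsum]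
  refine tsum_congr fun N => ?_
  rw [ofReal_integral_eq_lintegral_ofReal (hL1.integrable N) (hnn N),
    ← lintegral_const_mul' _ _ ENNReal.ofReal_ne_top]
  refine lintegral_congr fun v => ?_
  rw [← ENNReal.ofReal_mul (poissonWeight_pos hμ hρ N).le, gammaMul]
  congr 1
  ring

lemma mass_nonneg (hμ : 0 < μ) (hρ : 0 < ρ) (hpos : IsPositive h) : 0 ≤ mass μ ρ h := by
  refine tsum_nonneg fun N => mul_nonneg (poissonWeight_pos hμ hρ N).le
    (integral_nonneg_of_ae ?_)
  filter_upwards [hpos N] with v hv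
  exact mul_nonneg hv (maxwellian_pos N v).le

end Translation

end GrandKac

end


theorem lemma8 (μ ρ : ℝ) (hμ : 0 < μ) (hρ : 0 < ρ) (h : GrandKac.State)
    (hpos : GrandKac.IsPositive h)
    (hL1 : GrandKac.MemL1s (GrandKac.gammaMul μ ρ h))
    (hS : GrandKac.entropy μ ρ h < ⊤) :
    GrandKac.entropy μ ρ h ≤
      ((GrandKac.mass μ ρ h * Real.log (GrandKac.mass μ ρ h) : ℝ) : EReal) +
        ((μ / ρ : ℝ) : EReal) * (GrandKac.entropyProduction μ ρ h : EReal) := by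
  obtain ⟨F, hF, hF0, hFsym, hFh⟩ := GrandKac.exists_representative hμ hρ hpos hL1
  have hs : 0 < μ / ρ := div_pos hμ hρ
  have hprob := GrandKac.isProbabilityMeasure_compoundPoisson GrandKac.velocityLaw hs.le
  have hPos := GrandKac.entropyPos_eq_lintegral (μ := μ) (ρ := ρ) hF hFh
  have hNeg := GrandKac.entropyNeg_eq_lintegral (μ := μ) (ρ := ρ) hF hFh
  have hProd := GrandKac.entropyProduction_eq_lintegral (μ := μ) (ρ := ρ) hF hFh
  have hMass := GrandKac.lintegral_onConfig_eq_mass hμ hρ hpos hL1 hF hFh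
  have hMass0 := GrandKac.mass_nonneg hμ hρ hpos
  have hH := GrandKac.measurable_onConfig hF
  have hH0 : ∀ x, 0 ≤ GrandKac.onConfig F x := fun x => hF0 _ _
  have hsym : ∀ x y z, GrandKac.onConfig F (x * y * z) = GrandKac.onConfig F (x * z * y) :=
    fun x y z => GrandKac.onConfig_eq_of_perm hFsym (by
      simpa [mul_assoc, FreeMonoid.toList_mul] using List.perm_append_comm.append_left _)
  set P := GrandKac.compoundPoisson GrandKac.velocityLaw (μ / ρ)
  set H := GrandKac.onConfig F
  have hi : Integrable H P := by
    refine ⟨hH.aestronglyMeasurable, (hasFiniteIntegral_iff_ofReal (ae_of_all _ hH0)).2 ?_⟩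
    rw [hMass]
    exact ENNReal.ofReal_lt_top
  have hMassH : ∫ x, H x ∂P = GrandKac.mass μ ρ h := by
    rw [integral_eq_lintegral_of_nonneg_ae (ae_of_all _ hH0) hH.aestronglyMeasurable, hMass,
      ENNReal.toReal_ofReal hMass0]
  have hNegTop : GrandKac.entropyNeg μ ρ h ≠ ⊤ := by
    rw [hNeg]
    refine ((lintegral_mono (g := fun _ => 1) fun x => ?_).trans_lt (by simp)).ne
    refine ENNReal.ofReal_le_one.2 ?_
    linarith [Real.self_sub_one_le_mul_log (hH0 x), hH0 x]
  have hPosTop : GrandKac.entropyPos μ ρ h ≠ ⊤ := by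
    intro htop
    refine hS.ne ?_
    rw [GrandKac.entropy, htop, ← ENNReal.coe_toNNReal hNegTop]
    rfl
  have hl : Integrable (fun x => H x * Real.log (H x)) P := by
    have hm : Measurable fun x => H x * Real.log (H x) := by fun_prop
    refine ⟨hm.aestronglyMeasurable, ?_⟩
    have habs : ∀ x, ‖H x * Real.log (H x)‖ₑ ≤ ENNReal.ofReal (H x * Real.log (H x))
        + ENNReal.ofReal (-(H x * Real.log (H x))) := fun x => by
      rw [Real.enorm_eq_ofReal_abs]
      rcases abs_cases (H x * Real.log (H x)) with h1 | h1 <;> rw [h1.1]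
      · exact le_self_add
      · exact le_add_self
    refine (lintegral_mono habs).trans_lt ?_
    rw [lintegral_add_left (by fun_prop), ← hPos, ← hNeg]
    exact ENNReal.add_lt_top.2 ⟨hPosTop.lt_top, hNegTop.lt_top⟩
  have hEnt : GrandKac.entropy μ ρ h = ((∫ x, H x * Real.log (H x) ∂P : ℝ) : EReal) := by
    rw [integral_eq_lintegral_pos_part_sub_lintegral_neg_part hl, ← hPos, ← hNeg,
      GrandKac.entropy, EReal.coe_sub, EReal.coe_ennreal_toReal hPosTop,
      EReal.coe_ennreal_toReal hNegTop]
  by_cases hD : GrandKac.entropyProduction μ ρ h = ⊤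
  · rw [hD, EReal.coe_ennreal_top, EReal.coe_mul_top_of_pos hs, EReal.coe_add_top]
    exact le_top
  · rw [hEnt, ← EReal.coe_ennreal_toReal hD, ← EReal.coe_mul, ← EReal.coe_add, EReal.coe_le_coe_iff,
      ← hMassH, hProd]
    exact GrandKac.integral_mul_log_le_add_productionDensity GrandKac.velocityLaw hs.le hH hH0 hsym
      hi hl (hProd ▸ hD)
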